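/- Let $m>0$, let $g(x)=\dfrac{e^{-m|x|}}{4\pi|x|}$ be the Green function of $-\Delta+m^2$ in $\mathbb R^3$, and for $\varepsilon\ge 0$ let $K_m^{\varepsilon}=(-\Delta+m^2)^{-\varepsilon}$ be the smoothing operator on $L^2(\mathbb R^3)\otimes\mathbb C^4$, $$(K_m^\varepsilon\psi)(x)=\frac1{(2\pi)^3}\int_{\mathbb R^3}e^{-i\xi\cdot x}\,\frac{\hat\psi(\xi)}{(\xi^2+m^2)^{\varepsilon}}\,d^3\xi,\qquad \hat\psi(\xi)=\int_{\mathbb R^3}e^{i\xi\cdot x}\psi(x)\,d^3x ,$$ where the Fourier transform and its inverse are those of $L^2$. Let $J_1$ be the Bessel function of the first kind of order one and $\theta$ the Heaviside function. Let $\zeta\in C^1[0,\infty)\otimes\mathbb C^4$ be such that its second distributional derivative satisfies $\ddot\zeta\in L^2_{loc}[0,\infty)\otimes\mathbb C^4$, and put, for $t>0$ and $x\in\mathbb R^3\setminus\{0\}$, $$\varphi_S(x,t)=\frac{\theta(t-|x|)}{4\pi|x|}\,\zeta(t-|x|)-\frac{m}{4\pi}\int_0^t\frac{\theta(s-|x|)\,J_1\big(m\sqrt{s^2-|x|^2}\big)}{\sqrt{s^2-|x|^2}}\,\zeta(t-s)\,ds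 .$$ Then for every $t>0$ the function $\varphi_S(\cdot,t)-\zeta(t)g$ belongs to $L^2(\mathbb R^3)\otimes\mathbb C^4$, all the limits below exist, and $$\lim_{\varepsilon\to0+}\,\lim_{x\to0}K_m^\varepsilon\big(\varphi_S(\cdot,t)-\zeta(t)g\big)(x)=\lim_{x\to0}\big(\varphi_S(x,t)-\zeta(t)g(x)\big)=\frac1{4\pi}\Big(m\,\zeta(t)-\dot\zeta(t)-m\int_0^t\frac{J_1(ms)}{s}\,\zeta(t-s)\,ds\Big),$$ the inner limit on the left existing for every $\varepsilon>0$. Here a class $u\in L^2$ has the limit $\ell$ as $x\to0$ if for every neighbourhood $N$ of $\ell$ one has $u(x)\in N$ for almost every $x$ in some neighbourhood of $0$ (equivalently, some representative of $u$ has the limit $\ell$ as $x\to 0$). -/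

import Mathlib

open MeasureTheory Filter Topology Set
open scoped FourierTransform ENNReal ContDiff

noncomputable section

namespace ConcentratedDirac

/-- Physical space `ℝ³` with its Euclidean norm. -/
abbrev Space : Type := EuclideanSpace ℝ (Fin 3)

/-- The spinor space `ℂ⁴`. -/
abbrev Spinor : Type := EuclideanSpace ℂ (Fin 4)

/-- The Bessel function of the first kind of order one,
`J₁(z) = ∑ₖ (-1)ᵏ / (k! (k+1)!) (z/2)^(2k+1)`. -/
def besselJ1 (z : ℝ) : ℝ :=
  ∑' k : ℕ, (-1 : ℝ) ^ k / ((k.factorial : ℝ) * ((k + 1).factorial : ℝ)) * (z / 2) ^ (2 * k + 1)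

/-- The Heaviside function. -/
def heaviside (s : ℝ) : ℝ := if 0 ≤ s then 1 else 0

/-- The Green function of `-Δ + m²` in `ℝ³`. -/
def green (m : ℝ) (x : Space) : ℝ := Real.exp (-(m * ‖x‖)) / (4 * Real.pi * ‖x‖)

/-- The retarded solution of the Klein-Gordon equation with the source `ζ(t) δ(x)` and zero
initial data. -/
def phiS (m : ℝ) (ζ : ℝ → Spinor) (t : ℝ) (x : Space) : Spinor :=
  (heaviside (t - ‖x‖) / (4 * Real.pi * ‖x‖)) • ζ (t - ‖x‖)
    - (m / (4 * Real.pi)) • ∫ s in (0 : ℝ)..t,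
        (heaviside (s - ‖x‖) * besselJ1 (m * √(s ^ 2 - ‖x‖ ^ 2)) / √(s ^ 2 - ‖x‖ ^ 2)) • ζ (t - s)

/-- The part `φ_S(·,t) - ζ(t) g` of the field. -/
def regularPart (m : ℝ) (ζ : ℝ → Spinor) (t : ℝ) (x : Space) : Spinor :=
  phiS m ζ t x - green m x • ζ t

/-- The time derivative on the half-line `[0,∞)` (one-sided at `0`). -/
def dot (ζ : ℝ → Spinor) (t : ℝ) : Spinor := derivWithin ζ (Ici 0) t

/-- `η ∈ L²_loc[0,∞)`: square integrable on every compact interval `[0,T]`. -/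
def LocallyL2 (η : ℝ → Spinor) : Prop :=
  ∀ T : ℝ, MemLp η 2 (volume.restrict (Icc 0 T))

/-- `η` is the derivative of `u` in the sense of distributions on `(0,∞)`. -/
def IsWeakDeriv (u η : ℝ → Spinor) : Prop :=
  ∀ φ : ℝ → ℝ, ContDiff ℝ ∞ φ → HasCompactSupport φ → tsupport φ ⊆ Ioi 0 →
    ∫ s in Ioi (0 : ℝ), deriv φ s • u s = -∫ s in Ioi (0 : ℝ), φ s • η s

/-- The symbol of `(-Δ + m²)^(-ε)`. Mathlib's Fourier transform has the kernel
`exp (-2πi x·ξ)`, so `-Δ` has the symbol `(2π‖ξ‖)²`. -/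
def smoothingSymbol (m ε : ℝ) (ξ : Space) : ℝ := ((2 * Real.pi * ‖ξ‖) ^ 2 + m ^ 2) ^ (-ε)

/-- The symbol is bounded, so multiplication by it preserves `L²`. -/
theorem memLp_smoothingSymbol_smul {m ε : ℝ} (hm : 0 < m) (hε : 0 ≤ ε)
    (f : Lp Spinor 2 (volume : Measure Space)) :
    MemLp (fun ξ => smoothingSymbol m ε ξ • f ξ) 2 (volume : Measure Space) := by
  have hc : Continuous (smoothingSymbol m ε) := by
    unfold smoothingSymbol
    refine Continuous.rpow_const (by fun_prop) fun ξ => Or.inl ?_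
    positivity
  refine (Lp.memLp f).of_le_mul (c := (m ^ 2) ^ (-ε))
    (hc.aestronglyMeasurable.smul (Lp.aestronglyMeasurable f)) (Eventually.of_forall fun ξ => ?_)
  rw [norm_smul]
  refine mul_le_mul_of_nonneg_right ?_ (norm_nonneg _)
  have h0 : 0 ≤ smoothingSymbol m ε ξ := by unfold smoothingSymbol; positivity
  rw [Real.norm_of_nonneg h0]
  exact Real.rpow_le_rpow_of_nonpos (by positivity)
    (le_add_of_nonneg_left (by positivity)) (by linarith)

/-- The smoothing operator `K_m^ε = (-Δ + m²)^(-ε)` on `L²(ℝ³) ⊗ ℂ⁴`: the inverse Fourier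
transform of the symbol times the Fourier transform. -/
def smoothing (m ε : ℝ) (hm : 0 < m) (hε : 0 ≤ ε) (f : Lp Spinor 2 (volume : Measure Space)) :
    Lp Spinor 2 (volume : Measure Space) :=
  𝓕⁻ ((memLp_smoothingSymbol_smul hm hε (𝓕 f)).toLp _)

/-- The class `f` has the limit `ℓ` as `x → 0`: for every neighbourhood `N` of `ℓ`, `f x ∈ N` for
almost all `x` in some neighbourhood of `0`. This does not depend on the representative, and it
holds iff some representative has the limit `ℓ` in the ordinary sense. -/
def HasLimitAtZero (f : Lp Spinor 2 (volume : Measure Space)) (ℓ : Spinor) : Prop :=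
  Tendsto f (𝓝 (0 : Space) ⊓ ae volume) (𝓝 ℓ)

/-- The iterated limit `lim_{ε → 0+} lim_{x → 0} (K_m^ε f)(x)` exists and equals `L`. -/
def HasRenormalizedLimit (m : ℝ) (hm : 0 < m) (f : Lp Spinor 2 (volume : Measure Space))
    (L : Spinor) : Prop :=
  ∃ ℓ : ℝ → Spinor,
    (∀ (ε : ℝ) (hε : 0 < ε), HasLimitAtZero (smoothing m ε hm hε.le f) (ℓ ε)) ∧
      Tendsto ℓ (𝓝[>] 0) (𝓝 L)

/-- The common value of both limits. -/
def limitValue (m : ℝ) (ζ : ℝ → Spinor) (t : ℝ) : Spinor :=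
  (1 / (4 * Real.pi)) •
    (m • ζ t - dot ζ t - m • ∫ s in (0 : ℝ)..t, (besselJ1 (m * s) / s) • ζ (t - s))

end ConcentratedDirac

end

/-!
Put `f = φ_S(·,t) - ζ(t) g`, a function of `r = ‖x‖` only.

*Ordinary limit.* The `1/r` singularities of the retarded term and of `ζ(t) g` combine to
`(ζ(t - r) - exp (-m r) ζ(t)) / (4πr)`, a difference quotient at `r = 0` of a differentiable
function, so it has a limit (`tendsto_waveTerm`). The memory integral is continuous in `r` by
dominated convergence, since `|J₁(z)| ≤ |z|/2 * exp (z²/4)` bounds its kernel uniformly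
(`continuousAt_memoryTerm`). The same facts show that `f` is bounded by a multiple of
`exp (-m r)`, hence lies in `L²`, and that it is continuous away from the origin and from the light
cone `r = t`, hence almost everywhere.

*Smoothed limit.* The formula `(c + m²)^(-ε) = Γ(ε)⁻¹ ∫ s^(ε-1) exp (-m²s) exp (-cs) ds` expresses
`(-Δ + m²)^(-ε)` through the heat semigroup, so that it is the convolution with a nonnegative
kernel. This is checked on Schwartz functions (`fourier_smoothingSymbol_mul_fourierInv`) and passes
by duality to bounded `L²` functions (`smoothing_ae_eq_potential`). For `f` bounded and almost
everywhere continuous the convolution is continuous, so its limit at the origin is its value there.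
The kernel has mass `m^(-2ε) → 1` and a second moment `O(ε)`, so it is an approximate identity, and
the values at the origin tend to the ordinary limit of `f` (`tendsto_potential_zero`).
-/

namespace ConcentratedDirac

open scoped SchwartzMap

/-! ### The heat kernel -/

/-- The heat kernel of `ℝ³`: for `s > 0` it is the kernel of `exp (s Δ)`. -/
noncomputable def heatKernel (s : ℝ) (y : Space) : ℝ :=
  (1 / (4 * Real.pi * s)) ^ (3 / 2 : ℝ) * Real.exp (-(1 / (4 * s)) * ‖y‖ ^ 2)

theorem measurable_heatKernel : Measurable fun p : ℝ × Space => heatKernel p.1 p.2 := by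
  unfold heatKernel; fun_prop

theorem heatKernel_nonneg {s : ℝ} (hs : 0 < s) (y : Space) : 0 ≤ heatKernel s y := by
  unfold heatKernel; positivity

theorem integral_heatKernel {s : ℝ} (hs : 0 < s) : ∫ y, heatKernel s y = 1 := by
  unfold heatKernel
  rw [integral_const_mul, GaussianFourier.integral_rexp_neg_mul_sq_norm (by positivity),
    finrank_euclideanSpace_fin]
  norm_num only [Nat.cast_ofNat]
  rw [← Real.mul_rpow (by positivity) (by positivity)]
  convert Real.one_rpow _ using 2
  field_simp

theorem integrable_heatKernel {s : ℝ} (hs : 0 < s) : Integrable (heatKernel s) := by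
  by_contra h
  simpa [integral_undef h] using integral_heatKernel hs

/-- A factor `‖y‖²` costs a factor `s` and a doubling of the time. This replaces the exact second
moment of the Gaussian. -/
theorem sq_norm_mul_heatKernel_le {s : ℝ} (hs : 0 < s) (y : Space) :
    ‖y‖ ^ 2 * heatKernel s y ≤ 8 * 2 ^ (3 / 2 : ℝ) * s * heatKernel (2 * s) y := by
  have h1 : ‖y‖ ^ 2 / (8 * s) ≤ Real.exp (‖y‖ ^ 2 / (8 * s)) :=
    (Real.add_one_le_exp _).trans' (by linarith)
  have h2 : ‖y‖ ^ 2 ≤ 8 * s * Real.exp (‖y‖ ^ 2 / (8 * s)) := by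
    rwa [div_le_iff₀' (by positivity)] at h1
  have h3 : (1 / (4 * Real.pi * s)) ^ (3 / 2 : ℝ)
      = 2 ^ (3 / 2 : ℝ) * (1 / (4 * Real.pi * (2 * s))) ^ (3 / 2 : ℝ) := by
    rw [← Real.mul_rpow (by positivity) (by positivity)]
    congr 1; field_simp
  have h4 : Real.exp (‖y‖ ^ 2 / (8 * s)) * Real.exp (-(1 / (4 * s)) * ‖y‖ ^ 2)
      = Real.exp (-(1 / (4 * (2 * s))) * ‖y‖ ^ 2) := by
    rw [← Real.exp_add]; congr 1; field_simp; ring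
  calc ‖y‖ ^ 2 * heatKernel s y
      ≤ 8 * s * Real.exp (‖y‖ ^ 2 / (8 * s)) * heatKernel s y :=
        mul_le_mul_of_nonneg_right h2 (heatKernel_nonneg hs y)
    _ = _ := by unfold heatKernel; rw [← h4, h3]; ring

/-- Lebesgue measure on the half-space `{(s, y) | s > 0}` of times and space points. -/
noncomputable abbrev heatMeasure : Measure (ℝ × Space) :=
  (volume.restrict (Ioi (0 : ℝ))).prod volume

theorem integrable_mul_heatKernel {a : ℝ → ℝ} (ha : IntegrableOn a (Ioi 0)) {c : ℝ} (hc : 0 < c) :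
    Integrable (fun p : ℝ × Space => a p.1 * heatKernel (c * p.1) p.2) heatMeasure := by
  have hm : AEStronglyMeasurable (fun p : ℝ × Space => a p.1 * heatKernel (c * p.1) p.2)
      heatMeasure :=
    ha.aestronglyMeasurable.comp_fst.mul (measurable_heatKernel.comp
      (by fun_prop : Measurable fun p : ℝ × Space => (c * p.1, p.2))).aestronglyMeasurable
  rw [integrable_prod_iff hm]
  constructor
  · filter_upwards [ae_restrict_mem measurableSet_Ioi] with s hs
    exact (integrable_heatKernel (mul_pos hc hs)).const_mul _
  · refine ha.norm.congr ?_
    filter_upwards [ae_restrict_mem measurableSet_Ioi] with s hs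
    have hs' : 0 < c * s := mul_pos hc hs
    simp_rw [norm_mul, Real.norm_of_nonneg (heatKernel_nonneg hs' _), integral_const_mul,
      integral_heatKernel hs', mul_one]

theorem integral_mul_heatKernel {a : ℝ → ℝ} (ha : IntegrableOn a (Ioi 0)) {c : ℝ} (hc : 0 < c) :
    ∫ p : ℝ × Space, a p.1 * heatKernel (c * p.1) p.2 ∂heatMeasure = ∫ s in Ioi 0, a s := by
  rw [integral_prod _ (integrable_mul_heatKernel ha hc)]
  refine setIntegral_congr_fun measurableSet_Ioi fun s hs => ?_
  simp only [integral_const_mul, integral_heatKernel (mul_pos hc hs), mul_one]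

/-! ### Subordination of the smoothing operator to the heat semigroup -/

/-- The density of the representation
`(c + m²)^(-ε) = ∫ gammaWeight m ε s * exp (-c s) ds` over `s > 0`. -/
noncomputable def gammaWeight (m ε s : ℝ) : ℝ :=
  s ^ (ε - 1) * Real.exp (-(m ^ 2 * s)) / Real.Gamma ε

theorem gammaWeight_nonneg {m ε s : ℝ} (hε : 0 < ε) (hs : 0 < s) : 0 ≤ gammaWeight m ε s := by
  have := Real.Gamma_pos_of_pos hε
  unfold gammaWeight; positivity

theorem integral_gammaWeight_mul_exp {m ε : ℝ} (hm : 0 < m) (hε : 0 < ε) {c : ℝ} (hc : 0 ≤ c) :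
    ∫ s in Ioi 0, gammaWeight m ε s * Real.exp (-(c * s)) = (c + m ^ 2) ^ (-ε) := by
  have hG := (Real.Gamma_pos_of_pos hε).ne'
  have h0 : 0 < c + m ^ 2 := by positivity
  have h : ∀ s, gammaWeight m ε s * Real.exp (-(c * s))
      = s ^ (ε - 1) * Real.exp (-((c + m ^ 2) * s)) / Real.Gamma ε := fun s => by
    unfold gammaWeight
    rw [div_mul_eq_mul_div, mul_assoc, ← Real.exp_add]
    congr 3; ring_nf
  simp_rw [h]
  rw [integral_div, Real.integral_rpow_mul_exp_neg_mul_Ioi hε h0, mul_div_assoc, div_self hG,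
    mul_one, one_div, Real.inv_rpow h0.le, Real.rpow_neg h0.le]

theorem integral_gammaWeight {m ε : ℝ} (hm : 0 < m) (hε : 0 < ε) :
    ∫ s in Ioi 0, gammaWeight m ε s = (m ^ 2) ^ (-ε) := by
  simpa using integral_gammaWeight_mul_exp hm hε le_rfl

theorem integrableOn_gammaWeight {m ε : ℝ} (hm : 0 < m) (hε : 0 < ε) :
    IntegrableOn (gammaWeight m ε) (Ioi 0) := by
  by_contra h
  have := integral_gammaWeight hm hε
  rw [integral_undef h] at this
  exact (Real.rpow_pos_of_pos (by positivity : 0 < m ^ 2) (-ε)).ne this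

theorem mul_gammaWeight {m ε s : ℝ} (hε : 0 < ε) (hs : 0 < s) :
    s * gammaWeight m ε s = ε * gammaWeight m (ε + 1) s := by
  have hG := (Real.Gamma_pos_of_pos hε).ne'
  have hp : s ^ ε = s ^ (ε - 1) * s := by rw [← Real.rpow_add_one hs.ne', sub_add_cancel]
  unfold gammaWeight
  rw [Real.Gamma_add_one hε.ne', add_sub_cancel_right, hp]
  field_simp

/-- The kernel of `(-Δ + m²)^(-ε)` before integration over the time `s`. The integral over `s` alone
diverges at `y = 0` for small `ε`, so it is kept as a function of `(s, y)`, which is integrable for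
`heatMeasure`. -/
noncomputable def potentialKernel (m ε : ℝ) (p : ℝ × Space) : ℝ :=
  gammaWeight m ε p.1 * heatKernel p.1 p.2

theorem ae_heatMeasure_pos : ∀ᵐ p ∂heatMeasure, 0 < p.1 :=
  Measure.quasiMeasurePreserving_fst.ae (ae_restrict_mem measurableSet_Ioi)

theorem potentialKernel_nonneg {m ε : ℝ} (hε : 0 < ε) {p : ℝ × Space} (hp : 0 < p.1) :
    0 ≤ potentialKernel m ε p :=
  mul_nonneg (gammaWeight_nonneg hε hp) (heatKernel_nonneg hp _)

theorem integrable_potentialKernel {m ε : ℝ} (hm : 0 < m) (hε : 0 < ε) :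
    Integrable (potentialKernel m ε) heatMeasure := by
  simpa [potentialKernel] using!
    integrable_mul_heatKernel (integrableOn_gammaWeight hm hε) one_pos

theorem integral_potentialKernel {m ε : ℝ} (hm : 0 < m) (hε : 0 < ε) :
    ∫ p, potentialKernel m ε p ∂heatMeasure = (m ^ 2) ^ (-ε) := by
  rw [← integral_gammaWeight hm hε]
  simpa [potentialKernel] using
    integral_mul_heatKernel (integrableOn_gammaWeight hm hε) one_pos

theorem sq_norm_mul_potentialKernel_le {m ε : ℝ} (hε : 0 < ε) {p : ℝ × Space} (hp : 0 < p.1) :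
    ‖p.2‖ ^ 2 * potentialKernel m ε p ≤
      (8 * 2 ^ (3 / 2 : ℝ) * ε) * (gammaWeight m (ε + 1) p.1 * heatKernel (2 * p.1) p.2) := by
  calc ‖p.2‖ ^ 2 * potentialKernel m ε p
      = gammaWeight m ε p.1 * (‖p.2‖ ^ 2 * heatKernel p.1 p.2) := by unfold potentialKernel; ring
    _ ≤ gammaWeight m ε p.1 * (8 * 2 ^ (3 / 2 : ℝ) * p.1 * heatKernel (2 * p.1) p.2) :=
        mul_le_mul_of_nonneg_left (sq_norm_mul_heatKernel_le hp _) (gammaWeight_nonneg hε hp)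
    _ = (8 * 2 ^ (3 / 2 : ℝ)) * (p.1 * gammaWeight m ε p.1) * heatKernel (2 * p.1) p.2 := by ring
    _ = _ := by rw [mul_gammaWeight hε hp]; ring

theorem integrable_sq_norm_mul_potentialKernel {m ε : ℝ} (hm : 0 < m) (hε : 0 < ε) :
    Integrable (fun p : ℝ × Space => ‖p.2‖ ^ 2 * potentialKernel m ε p) heatMeasure := by
  refine ((integrable_mul_heatKernel (integrableOn_gammaWeight hm (add_pos hε one_pos))
    two_pos).const_mul (8 * 2 ^ (3 / 2 : ℝ) * ε)).mono' ?_ ?_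
  · exact (by fun_prop : Continuous fun p : ℝ × Space => ‖p.2‖ ^ 2).aestronglyMeasurable.mul
      (integrable_potentialKernel hm hε).aestronglyMeasurable
  · filter_upwards [ae_heatMeasure_pos] with p hp
    rw [Real.norm_of_nonneg (mul_nonneg (by positivity) (potentialKernel_nonneg hε hp))]
    exact sq_norm_mul_potentialKernel_le hε hp

/-- The factor `ε` makes the kernel concentrate at `y = 0` as `ε → 0`. -/
theorem integral_sq_norm_mul_potentialKernel_le {m ε : ℝ} (hm : 0 < m) (hε : 0 < ε) :
    ∫ p : ℝ × Space, ‖p.2‖ ^ 2 * potentialKernel m ε p ∂heatMeasure ≤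
      8 * 2 ^ (3 / 2 : ℝ) * ε * (m ^ 2) ^ (-(ε + 1)) := by
  rw [← integral_gammaWeight hm (add_pos hε one_pos), ← integral_mul_heatKernel
    (integrableOn_gammaWeight hm (add_pos hε one_pos)) two_pos, ← integral_const_mul]
  refine integral_mono_ae (integrable_sq_norm_mul_potentialKernel hm hε)
    ((integrable_mul_heatKernel (integrableOn_gammaWeight hm (add_pos hε one_pos))
      two_pos).const_mul _) ?_
  filter_upwards [ae_heatMeasure_pos] with p hp
  exact sq_norm_mul_potentialKernel_le hε hp

theorem hasTemperateGrowth_smoothingSymbol {m : ℝ} (hm : 0 < m) (ε : ℝ) :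
    (smoothingSymbol m ε).HasTemperateGrowth := by
  have h : smoothingSymbol m ε
      = fun ξ => (m ^ 2) ^ (-ε) * (1 + ‖(2 * Real.pi / m) • ξ‖ ^ 2) ^ (-ε) := by
    funext ξ
    unfold smoothingSymbol
    rw [← Real.mul_rpow (by positivity) (by positivity), norm_smul,
      Real.norm_of_nonneg (by positivity)]
    congr 1; field_simp; ring
  rw [h]
  have h1 : (fun ξ : Space => (2 * Real.pi / m) • ξ).HasTemperateGrowth := by fun_prop
  have h2 := (Function.hasTemperateGrowth_one_add_norm_sq_rpow Space (-ε)).comp h1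
  exact (Function.HasTemperateGrowth.const ((m ^ 2) ^ (-ε))).mul h2

/-- The heat semigroup applied to `φ`, on the Fourier side and as a convolution. The multiplier
`exp (-(2π‖ξ‖)² s)` is even, so it does not matter that the outer transform is the direct and the
inner one the inverse Fourier transform. -/
theorem integral_gaussian_mul_fourierInv {s : ℝ} (hs : 0 < s) (φ : 𝓢(Space, ℂ)) (x : Space) :
    ∫ ξ : Space, (Real.exp (-((2 * Real.pi * ‖ξ‖) ^ 2 * s)) : ℂ) *
        (Real.fourierChar (-inner ℝ ξ x) • (𝓕⁻ φ) ξ)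
      = ∫ y : Space, (heatKernel s y : ℂ) * φ (x - y) := by
  have hb : 0 < ((4 * Real.pi ^ 2 * s : ℝ) : ℂ).re := by
    rw [Complex.ofReal_re]; positivity
  have J : Integrable (fun w : Space => Complex.exp (-((4 * Real.pi ^ 2 * s : ℝ) : ℂ) * ‖w‖ ^ 2 +
      2 * Real.pi * Complex.I * inner ℝ x w)) :=
    GaussianFourier.integrable_cexp_neg_mul_sq_norm_add hb _ _
  have key := VectorFourier.integral_fourierIntegral_smul_eq_flip (L := innerₗ Space)
      Real.continuous_fourierChar continuous_inner J (φ.integrable (μ := volume))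
  rw [flip_innerₗ] at key
  rw [← integral_neg_eq_self]
  trans ∫ ξ : Space, Complex.exp (-((4 * Real.pi ^ 2 * s : ℝ) : ℂ) * ‖ξ‖ ^ 2 +
      2 * Real.pi * Complex.I * inner ℝ x ξ) • (𝓕 (φ : Space → ℂ)) ξ
  · refine integral_congr_ae (Eventually.of_forall fun ξ => ?_)
    simp only [norm_neg, inner_neg_left, neg_neg]
    rw [SchwartzMap.fourierInv_coe, Real.fourierInv_eq_fourier_neg, neg_neg,
      Circle.smul_def, Real.fourierChar_apply, smul_eq_mul, smul_eq_mul, ← mul_assoc,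
      Complex.ofReal_exp, ← Complex.exp_add, real_inner_comm]
    congr 2
    push_cast; ring
  · refine (key.symm.trans ?_ :)
    rw [← integral_sub_left_eq_self _ volume x]
    refine integral_congr_ae (Eventually.of_forall fun y => ?_)
    have h := fourier_gaussian_innerProductSpace' hb x (x - y)
    rw [sub_sub_cancel, finrank_euclideanSpace_fin] at h
    simp only [smul_eq_mul]
    congr 1
    refine (h :).trans ?_
    -- With `b = 4π²s`, the transform of the Gaussian is the heat kernel at time `s`.
    unfold heatKernel
    push_cast
    rw [Complex.ofReal_cpow (by positivity)]
    push_cast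
    congr 2
    · field_simp
    · field_simp

/-- On Schwartz functions the Fourier multiplier `smoothingSymbol m ε` is the convolution with
`potentialKernel m ε`. -/
theorem fourier_smoothingSymbol_mul_fourierInv {m ε : ℝ} (hm : 0 < m) (hε : 0 < ε)
    (φ : 𝓢(Space, ℂ)) (x : Space) :
    𝓕 (SchwartzMap.smulLeftCLM ℂ (smoothingSymbol m ε) (𝓕⁻ φ)) x
      = ∫ p, (potentialKernel m ε p : ℂ) * φ (x - p.2) ∂heatMeasure := by
  have hbd : ∃ C, ∀ x, ‖φ x‖ ≤ C := ⟨_, fun x => φ.toBoundedContinuousFunction.norm_coe_le_norm x⟩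
  obtain ⟨C, hC⟩ := hbd
  have hI : Integrable (fun p : ℝ × Space => (potentialKernel m ε p : ℂ) * φ (x - p.2))
      heatMeasure := by
    refine (integrable_potentialKernel hm hε).ofReal.mul_bdd (c := C) ?_
      (Eventually.of_forall fun p => hC _)
    exact (φ.continuous.comp (by fun_prop)).aestronglyMeasurable
  let F : Space × ℝ → ℂ := fun q => (gammaWeight m ε q.2 : ℂ) *
    ((Real.exp (-((2 * Real.pi * ‖q.1‖) ^ 2 * q.2)) : ℂ) *
        (Real.fourierChar (-inner ℝ q.1 x) • (𝓕⁻ φ) q.1))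
  have hF : Integrable F (volume.prod (volume.restrict (Ioi 0))) := by
    have h := ((𝓕⁻ φ).integrable (μ := volume)).mul_prod
      ((integrableOn_gammaWeight hm hε).ofReal (𝕜 := ℂ)) 
    refine h.norm.mono' ?_ ?_
    · refine (integrableOn_gammaWeight hm hε).ofReal.aestronglyMeasurable.comp_snd.mul ?_
      have := (𝓕⁻ φ).continuous
      simp only [Circle.smul_def]
      exact Continuous.aestronglyMeasurable (by fun_prop)
    · filter_upwards [Measure.quasiMeasurePreserving_snd.ae
        (ae_restrict_mem (measurableSet_Ioi (a := (0:ℝ))))] with q hq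
      have hq : 0 < q.2 := hq
      simp only [F, norm_mul, Circle.norm_smul]
      refine (mul_le_mul_of_nonneg_left ?_ (norm_nonneg _)).trans_eq (mul_comm _ _)
      rw [Complex.norm_real, Real.norm_of_nonneg (Real.exp_nonneg _)]
      refine mul_le_of_le_one_left (norm_nonneg _) (Real.exp_le_one_iff.2 ?_)
      have : 0 ≤ (2 * Real.pi * ‖q.1‖) ^ 2 * q.2 := by positivity
      linarith
  rw [SchwartzMap.fourier_coe, Real.fourier_eq]
  trans ∫ ξ, ∫ s in Ioi 0, F (ξ, s)
  · refine integral_congr_ae (Eventually.of_forall fun ξ => ?_)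
    have h := integral_gammaWeight_mul_exp hm hε (sq_nonneg (2 * Real.pi * ‖ξ‖))
    simp only [F, ← mul_assoc]
    rw [SchwartzMap.smulLeftCLM_apply_apply (hasTemperateGrowth_smoothingSymbol hm ε),
      integral_mul_const]
    simp only [← Complex.ofReal_mul]
    rw [integral_complex_ofReal, h, smul_comm, Complex.real_smul]
    rfl
  · rw [integral_integral_swap hF, integral_prod _ hI]
    refine setIntegral_congr_fun measurableSet_Ioi fun s hs => ?_
    simp only [F, potentialKernel, Complex.ofReal_mul (gammaWeight _ _ _),
      mul_assoc (Complex.ofReal _), integral_const_mul]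
    rw [← integral_gaussian_mul_fourierInv hs]

/-! ### The smoothing operator as a convolution -/

/-- The convolution of `f` with the kernel of `(-Δ + m²)^(-ε)`, written with `x + y` since the
kernel is even. -/
noncomputable def potential (m ε : ℝ) (f : Space → Spinor) (x : Space) : Spinor :=
  ∫ p, potentialKernel m ε p • f (x + p.2) ∂heatMeasure

variable {m ε C : ℝ} {f : Space → Spinor}

/-- Convolution with the even kernel is symmetric. -/
theorem integral_smul_potential (hm : 0 < m) (hε : 0 < ε) (hf : StronglyMeasurable f)
    (hC : ∀ x, ‖f x‖ ≤ C) (φ : 𝓢(Space, ℂ)) :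
    ∫ x, φ x • potential m ε f x =
      ∫ x, (∫ p, (potentialKernel m ε p : ℂ) * φ (x - p.2) ∂heatMeasure) • f x := by
  let H : (ℝ × Space) × Space → Spinor := fun q =>
    ((potentialKernel m ε q.1 : ℂ) * φ q.2) • f (q.2 + q.1.2)
  have hH : Integrable H (heatMeasure.prod volume) := by
    refine (((integrable_potentialKernel hm hε).ofReal (𝕜 := ℂ)).mul_prod
      (φ.integrable (μ := volume))).smul_bdd C ?_ (Eventually.of_forall fun q => hC _)
    exact (hf.comp_measurable (by fun_prop)).aestronglyMeasurable
  have hT : MeasurePreserving (fun q : (ℝ × Space) × Space => (q.1, q.2 - q.1.2))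
      (heatMeasure.prod volume) (heatMeasure.prod volume) :=
    (MeasurePreserving.id heatMeasure).skew_product (g := fun p x => x - p.2) (by fun_prop)
      (Eventually.of_forall fun p => (measurePreserving_sub_right volume p.2).map_eq)
  have hG : Integrable (fun q : (ℝ × Space) × Space =>
      ((potentialKernel m ε q.1 : ℂ) * φ (q.2 - q.1.2)) • f q.2) (heatMeasure.prod volume) := by
    simpa [H, Function.comp_def] using hT.integrable_comp_of_integrable hH
  calc ∫ x, φ x • potential m ε f x
      = ∫ x, ∫ p, H (p, x) ∂heatMeasure := by
        refine integral_congr_ae (Eventually.of_forall fun x => ?_)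
        simp only [potential, H]
        rw [← integral_smul]
        refine integral_congr_ae (Eventually.of_forall fun p => ?_)
        simp only [mul_comm _ (φ x), mul_smul, Complex.coe_smul]
    _ = ∫ p, (∫ x, H (p, x)) ∂heatMeasure :=
        (integral_integral_swap (f := fun p x => H (p, x)) hH).symm
    _ = ∫ p, (∫ x, ((potentialKernel m ε p : ℂ) * φ (x - p.2)) • f x) ∂heatMeasure := by
        refine integral_congr_ae (Eventually.of_forall fun p => ?_)
        refine (integral_sub_right_eq_self _ p.2).symm.trans ?_
        simp [H]
    _ = ∫ x, ∫ p, ((potentialKernel m ε p : ℂ) * φ (x - p.2)) • f x ∂heatMeasure :=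
        integral_integral_swap hG
    _ = _ := by simp_rw [integral_smul_const]

theorem norm_potential_le (hm : 0 < m) (hε : 0 < ε) (hC : ∀ x, ‖f x‖ ≤ C) (x : Space) :
    ‖potential m ε f x‖ ≤ ∫ p, ‖potentialKernel m ε p‖ * C ∂heatMeasure := by
  refine norm_integral_le_of_norm_le ((integrable_potentialKernel hm hε).norm.mul_const C)
    (Eventually.of_forall fun p => ?_)
  rw [norm_smul]
  exact mul_le_mul_of_nonneg_left (hC _) (norm_nonneg _)

theorem aestronglyMeasurable_potential (hm : 0 < m) (hε : 0 < ε) (hf : StronglyMeasurable f) :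
    AEStronglyMeasurable (potential m ε f) volume := by
  have h : AEStronglyMeasurable (fun q : Space × (ℝ × Space) =>
      potentialKernel m ε q.2 • f (q.1 + q.2.2)) (volume.prod heatMeasure) :=
    (integrable_potentialKernel hm hε).aestronglyMeasurable.comp_snd.smul
      (hf.comp_measurable (by fun_prop)).aestronglyMeasurable
  exact h.integral_prod_right'

/-- The smoothing operator is symmetric for the bilinear pairing with Schwartz functions; the `L²`
Fourier transform is moved onto the test function through tempered distributions. -/
theorem integral_smul_smoothing (hm : 0 < m) (hε : 0 ≤ ε)
    (F : Lp Spinor 2 (volume : Measure Space)) (φ : 𝓢(Space, ℂ)) :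
    ∫ x, φ x • smoothing m ε hm hε F x =
      ∫ x, 𝓕 (SchwartzMap.smulLeftCLM ℂ (smoothingSymbol m ε) (𝓕⁻ φ)) x • F x := by
  rw [← Lp.toTemperedDistribution_apply, ← Lp.toTemperedDistribution_apply, smoothing,
    ← Lp.fourierInv_toTemperedDistribution_eq, TemperedDistribution.fourierInv_apply,
    ← TemperedDistribution.fourier_apply, Lp.fourier_toTemperedDistribution_eq,
    Lp.toTemperedDistribution_apply, Lp.toTemperedDistribution_apply]
  refine integral_congr_ae ?_
  filter_upwards [(memLp_smoothingSymbol_smul hm hε (𝓕 F)).coeFn_toLp] with ξ hξ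
  rw [hξ, SchwartzMap.smulLeftCLM_apply_apply (hasTemperateGrowth_smoothingSymbol hm ε),
    smul_assoc, smul_comm]

theorem smoothing_ae_eq_potential (hm : 0 < m) (hε : 0 < ε) (hf : StronglyMeasurable f)
    (hC : ∀ x, ‖f x‖ ≤ C) (h2 : MemLp f 2 volume) :
    smoothing m ε hm hε.le (h2.toLp f) =ᵐ[volume] potential m ε f := by
  refine ae_eq_of_integral_contDiff_smul_eq ((Lp.memLp _).locallyIntegrable one_le_two)
    ((memLp_top_of_bound (aestronglyMeasurable_potential hm hε hf) _
      (Eventually.of_forall (norm_potential_le hm hε hC))).locallyIntegrable le_top)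
    fun g hg hgc => ?_
  have hc : HasCompactSupport fun x => (g x : ℂ) := hgc.comp_left Complex.ofReal_zero
  let φ : 𝓢(Space, ℂ) := hc.toSchwartzMap (Complex.ofRealCLM.contDiff.comp hg)
  have hφ : ∀ (x : Space) (v : Spinor), g x • v = φ x • v := fun x v => (Complex.coe_smul _ _).symm
  simp_rw [hφ]
  rw [integral_smul_smoothing, integral_smul_potential hm hε hf hC]
  refine integral_congr_ae ?_
  filter_upwards [h2.coeFn_toLp] with x hx
  rw [hx, fourier_smoothingSymbol_mul_fourierInv hm hε]

theorem ae_heatMeasure_of_ae {P : Space → Prop} (h : ∀ᵐ y, P y) : ∀ᵐ p ∂heatMeasure, P p.2 :=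
  Measure.quasiMeasurePreserving_snd.ae h

/-! ### Limits of the convolution -/

/-- For a bounded `f`, continuity at almost every point suffices, by dominated convergence. -/
theorem tendsto_potential_nhds_zero (hm : 0 < m) (hε : 0 < ε) (hf : StronglyMeasurable f)
    (hC : ∀ x, ‖f x‖ ≤ C) (hcont : ∀ᵐ y, ContinuousAt f y) :
    Tendsto (potential m ε f) (𝓝 0) (𝓝 (potential m ε f 0)) := by
  refine tendsto_integral_filter_of_dominated_convergence
    (fun p => ‖potentialKernel m ε p‖ * C) (Eventually.of_forall fun x => ?_)
    (Eventually.of_forall fun x => Eventually.of_forall fun p => ?_)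
    ((integrable_potentialKernel hm hε).norm.mul_const C) ?_
  · exact (integrable_potentialKernel hm hε).aestronglyMeasurable.smul
      (hf.comp_measurable (by fun_prop)).aestronglyMeasurable
  · rw [norm_smul]
    exact mul_le_mul_of_nonneg_left (hC _) (norm_nonneg _)
  · filter_upwards [ae_heatMeasure_of_ae hcont] with p hp
    refine Tendsto.const_smul (Tendsto.comp (g := f) (y := 𝓝 (0 + p.2)) ?_ ?_) _
    · rw [zero_add]; exact hp
    · exact (continuous_add_const p.2).tendsto 0

/-- A quadratic modulus of continuity of `f` at `0` is integrated against the zeroth and second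
moments of the kernel. -/
theorem norm_potential_sub_le (hm : 0 < m) (hε : 0 < ε) (hf : StronglyMeasurable f)
    (hC : ∀ x, ‖f x‖ ≤ C) {L : Spinor} {a b : ℝ} (hb : 0 ≤ b)
    (hL : ∀ᵐ y, ‖f y - L‖ ≤ a + b * ‖y‖ ^ 2) :
    ‖potential m ε f 0 - (m ^ 2) ^ (-ε) • L‖ ≤
      a * (m ^ 2) ^ (-ε) + b * (8 * 2 ^ (3 / 2 : ℝ) * ε * (m ^ 2) ^ (-(ε + 1))) := by
  have hk := integrable_potentialKernel hm hε
  have h1 : Integrable (fun p : ℝ × Space => potentialKernel m ε p • f (0 + p.2)) heatMeasure :=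
    hk.smul_bdd C (hf.comp_measurable (by fun_prop)).aestronglyMeasurable
      (Eventually.of_forall fun p => hC _)
  rw [← integral_potentialKernel hm hε, ← integral_smul_const, potential,
    ← integral_sub h1 (hk.smul_const L)]
  have h2 := integrable_sq_norm_mul_potentialKernel hm hε
  refine (norm_integral_le_of_norm_le ((hk.const_mul a).add (h2.const_mul b)) ?_).trans ?_
  · filter_upwards [ae_heatMeasure_pos, ae_heatMeasure_of_ae hL] with p hp hp2
    have h0 := potentialKernel_nonneg (m := m) hε hp
    rw [zero_add, ← smul_sub, norm_smul, Real.norm_of_nonneg h0]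
    refine (mul_le_mul_of_nonneg_left hp2 h0).trans_eq ?_
    simp only [Pi.add_apply]; ring
  · rw [integral_add' (hk.const_mul a) (h2.const_mul b), integral_const_mul, integral_const_mul]
    gcongr
    exact integral_sq_norm_mul_potentialKernel_le hm hε

theorem tendsto_potential_zero (hm : 0 < m) (hf : StronglyMeasurable f)
    (hC : ∀ x, ‖f x‖ ≤ C) {L : Spinor} (hL : Tendsto f (𝓝[≠] 0) (𝓝 L)) :
    Tendsto (fun ε => potential m ε f 0) (𝓝[>] 0) (𝓝 L) := by
  have hm2 : (m ^ 2 : ℝ) ≠ 0 := by positivity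
  have hid : Tendsto (fun ε : ℝ => ε) (𝓝[>] 0) (𝓝 0) := nhdsWithin_le_nhds
  have hmass : Tendsto (fun ε : ℝ => (m ^ 2) ^ (-ε)) (𝓝[>] 0) (𝓝 1) := by
    simpa [Function.comp_def] using (Real.continuousAt_const_rpow hm2).tendsto.comp hid.neg
  have hmass' : Tendsto (fun ε : ℝ => (m ^ 2) ^ (-(ε + 1))) (𝓝[>] 0)
      (𝓝 ((m ^ 2) ^ (-(0 + 1) : ℝ))) := 
    (Real.continuousAt_const_rpow hm2).tendsto.comp (hid.add_const 1).neg
  have hsub : Tendsto (fun ε => potential m ε f 0 - (m ^ 2) ^ (-ε) • L) (𝓝[>] 0) (𝓝 0) := by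
    refine Metric.tendsto_nhds.2 fun η hη => ?_
    obtain ⟨δ, hδ, hδL⟩ := Metric.eventually_nhds_iff.1
      (eventually_nhdsWithin_iff.1 (Metric.tendsto_nhds.1 hL (η / 2) (half_pos hη)))
    have hC0 : 0 ≤ C := (norm_nonneg _).trans (hC 0)
    -- Beyond the distance `δ` the crude bound `C + ‖L‖` is absorbed by `b * ‖y‖ ^ 2`.
    set b : ℝ := (C + ‖L‖) / δ ^ 2 with hbdef
    have hb : 0 ≤ b := by positivity
    have hbound : ∀ᵐ y : Space, ‖f y - L‖ ≤ η / 2 + b * ‖y‖ ^ 2 := by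
      filter_upwards [Measure.ae_ne volume (0 : Space)] with y hy
      rcases lt_or_ge ‖y‖ δ with h | h
      · have := hδL (y := y) (by simpa using h) hy
        rw [dist_eq_norm] at this
        have : 0 ≤ b * ‖y‖ ^ 2 := by positivity
        linarith
      · have h3 : C + ‖L‖ ≤ b * ‖y‖ ^ 2 := by
          rw [hbdef, div_mul_eq_mul_div, le_div_iff₀ (by positivity)]
          gcongr
        have := (norm_sub_le (f y) L).trans (add_le_add_left (hC y) _)
        linarith
    have hlim : Tendsto (fun ε : ℝ => η / 2 * (m ^ 2) ^ (-ε) +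
        b * (8 * 2 ^ (3 / 2 : ℝ) * ε * (m ^ 2) ^ (-(ε + 1)))) (𝓝[>] 0) (𝓝 (η / 2)) := by
      simpa using (hmass.const_mul (η / 2)).add
        (((hid.const_mul (8 * 2 ^ (3 / 2 : ℝ))).mul hmass').const_mul b)
    filter_upwards [hlim.eventually_lt_const (half_lt_self hη), self_mem_nhdsWithin] with ε h1 hε
    rw [dist_zero_right]
    exact (norm_potential_sub_le hm hε hf hC hb hbound).trans_lt h1
  simpa using hsub.add (hmass.smul_const L)

/-- The smoothed limit agrees with the pointwise limit for every bounded, almost everywhere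
continuous `L²` function which has a limit at the origin. -/
theorem hasRenormalizedLimit_toLp (hm : 0 < m) (hf : StronglyMeasurable f)
    (hC : ∀ x, ‖f x‖ ≤ C) (hcont : ∀ᵐ y, ContinuousAt f y) {L : Spinor}
    (hL : Tendsto f (𝓝[≠] 0) (𝓝 L)) (h2 : MemLp f 2 volume) :
    HasRenormalizedLimit m hm (h2.toLp f) L := by
  refine ⟨fun ε => potential m ε f 0, fun ε hε => ?_, tendsto_potential_zero hm hf hC hL⟩
  have h := (tendsto_potential_nhds_zero hm hε hf hC hcont).mono_left
    (inf_le_left : 𝓝 0 ⊓ ae volume ≤ 𝓝 (0 : Space))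
  refine h.congr' ?_
  exact (smoothing_ae_eq_potential hm hε hf hC h2).symm.filter_mono inf_le_right

/-! ### The Bessel function `J₁` -/

/-- The factor `(k + 1)!` is bounded below by `1`, which leaves an exponential series. -/
theorem norm_besselJ1_term_le {z R : ℝ} (hz : |z| ≤ R) (k : ℕ) :
    ‖(-1 : ℝ) ^ k / ((k.factorial : ℝ) * ((k + 1).factorial : ℝ)) * (z / 2) ^ (2 * k + 1)‖ ≤
      R / 2 * ((R ^ 2 / 4) ^ k / k.factorial) := by
  have h1 : (1 : ℝ) ≤ (k + 1).factorial := by exact_mod_cast (k + 1).factorial_pos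
  have h2 : |z / 2| ≤ R / 2 := by rw [abs_div, abs_two]; linarith
  have h0 : 0 ≤ R := (abs_nonneg z).trans hz
  have h3 : R / 2 * ((R ^ 2 / 4) ^ k / k.factorial)
      = 1 / (k.factorial : ℝ) * (R / 2) ^ (2 * k + 1) := by
    rw [pow_succ (R / 2), pow_mul (R / 2), div_pow R 2]; ring
  rw [h3, norm_mul, norm_div, norm_pow, norm_neg, norm_one, one_pow, norm_pow, Real.norm_eq_abs,
    Real.norm_eq_abs, abs_of_nonneg (by positivity)]
  gcongr
  exact le_mul_of_one_le_right (by positivity) h1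

theorem continuous_besselJ1 : Continuous besselJ1 := by
  refine continuous_iff_continuousAt.2 fun z => ?_
  have h : ContinuousOn besselJ1 (Icc (-(|z| + 1)) (|z| + 1)) :=
    continuousOn_tsum (fun k => by fun_prop)
      ((Real.summable_pow_div_factorial _).mul_left _)
      fun k w hw => norm_besselJ1_term_le (abs_le.2 hw) k
  refine h.continuousAt (Icc_mem_nhds ?_ ?_)
  · have := neg_abs_le z; linarith
  · have := le_abs_self z; linarith

theorem abs_besselJ1_le (z : ℝ) : |besselJ1 z| ≤ |z| / 2 * Real.exp (z ^ 2 / 4) := by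
  have h : HasSum (fun k : ℕ => |z| / 2 * ((|z| ^ 2 / 4) ^ k / k.factorial))
      (|z| / 2 * Real.exp (z ^ 2 / 4)) := by
    have h0 := NormedSpace.expSeries_div_hasSum_exp (z ^ 2 / 4)
    rw [← Real.exp_eq_exp_ℝ] at h0
    simpa only [sq_abs] using h0.mul_left (|z| / 2)
  unfold besselJ1
  rw [← Real.norm_eq_abs]
  exact tsum_of_norm_bounded h (norm_besselJ1_term_le le_rfl)

/-! ### The memory integral -/

/-- The scalar factor in the integral of `phiS` at distance `r` from the source. -/
noncomputable def memoryKernel (m r s : ℝ) : ℝ :=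
  heaviside (s - r) * besselJ1 (m * √(s ^ 2 - r ^ 2)) / √(s ^ 2 - r ^ 2)

theorem measurable_heaviside : Measurable heaviside :=
  Measurable.ite measurableSet_Ici measurable_const measurable_const

theorem abs_heaviside_le (s : ℝ) : |heaviside s| ≤ 1 := by
  unfold heaviside; split_ifs <;> simp

/-- Where the square root vanishes the quotient is `0`, so the bound holds without exception. -/
theorem abs_memoryKernel_le {m r s t : ℝ} (hm : 0 < m) (hs : 0 ≤ s) (hst : s ≤ t) :
    |memoryKernel m r s| ≤ m / 2 * Real.exp (m ^ 2 * t ^ 2 / 4) := by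
  unfold memoryKernel
  set w := √(s ^ 2 - r ^ 2) with hw
  have hw0 : 0 ≤ w := Real.sqrt_nonneg _
  have hwt : w ^ 2 ≤ t ^ 2 := by
    have h1 : w ≤ s := (Real.sqrt_le_sqrt (by nlinarith [sq_nonneg r])).trans_eq (Real.sqrt_sq hs)
    gcongr; exact h1.trans hst
  have h2 : |heaviside (s - r) * besselJ1 (m * w)| ≤ m / 2 * Real.exp (m ^ 2 * t ^ 2 / 4) * w := by
    rw [abs_mul]
    refine (mul_le_of_le_one_left (abs_nonneg _) (abs_heaviside_le _)).trans ?_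
    refine (abs_besselJ1_le _).trans ?_
    rw [abs_of_nonneg (by positivity), mul_pow]
    calc m * w / 2 * Real.exp (m ^ 2 * w ^ 2 / 4) ≤ m * w / 2 * Real.exp (m ^ 2 * t ^ 2 / 4) := by
          gcongr
      _ = _ := by ring
  rw [abs_div, abs_of_nonneg hw0]
  exact div_le_of_le_mul₀ hw0 (by positivity) h2

theorem measurable_memoryKernel (m r : ℝ) : Measurable (memoryKernel m r) := by
  have h1 := measurable_heaviside
  have h2 := continuous_besselJ1.measurable
  unfold memoryKernel
  fun_prop

/-- The Heaviside factor jumps only at `s = r`, a null set of times for each `r`. -/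
theorem continuousAt_memoryKernel {m r₀ s : ℝ} (hr₀ : 0 ≤ r₀) (hne : s ≠ r₀) :
    ContinuousAt (fun r => memoryKernel m r s) r₀ := by
  rcases lt_or_gt_of_ne hne with h | h
  · have : (fun r => memoryKernel m r s) =ᶠ[𝓝 r₀] fun _ => 0 := by
      filter_upwards [lt_mem_nhds h] with r hr
      simp [memoryKernel, heaviside, hr]
    exact continuousAt_const.congr this.symm
  · have : (fun r => memoryKernel m r s) =ᶠ[𝓝 r₀]
        fun r => besselJ1 (m * √(s ^ 2 - r ^ 2)) / √(s ^ 2 - r ^ 2) := by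
      filter_upwards [gt_mem_nhds h] with r hr
      simp [memoryKernel, heaviside, hr.le]
    refine ContinuousAt.congr ?_ this.symm
    have hpos : √(s ^ 2 - r₀ ^ 2) ≠ 0 := by
      have : r₀ ^ 2 < s ^ 2 := by gcongr
      exact (Real.sqrt_pos.2 (by linarith)).ne'
    have := continuous_besselJ1
    exact ContinuousAt.div (by fun_prop) (by fun_prop) hpos

/-- The integral in `phiS`, without its prefactor, as a function of `r = ‖x‖`. -/
noncomputable def memoryTerm (m : ℝ) (ζ : ℝ → Spinor) (t r : ℝ) : Spinor :=
  ∫ s in (0 : ℝ)..t, memoryKernel m r s • ζ (t - s)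

variable {t : ℝ} {ζ : ℝ → Spinor}

theorem exists_norm_sub_le (hζ : ContinuousOn ζ (Ici 0)) (ht : 0 < t) :
    ∃ M, ∀ s ∈ uIoc 0 t, ‖ζ (t - s)‖ ≤ M := by
  obtain ⟨M, hM⟩ := isCompact_Icc.exists_bound_of_continuousOn
    (hζ.mono (Icc_subset_Ici_self : Icc 0 t ⊆ Ici 0))
  refine ⟨M, fun s hs => hM _ ?_⟩
  rw [uIoc_of_le ht.le] at hs
  exact ⟨by linarith [hs.2], by linarith [hs.1]⟩

theorem exists_norm_memoryKernel_smul_le (hm : 0 < m) (hζ : ContinuousOn ζ (Ici 0)) (ht : 0 < t) :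
    ∃ B, ∀ r, ∀ s ∈ uIoc 0 t, ‖memoryKernel m r s • ζ (t - s)‖ ≤ B := by
  obtain ⟨M, hM⟩ := exists_norm_sub_le hζ ht
  refine ⟨m / 2 * Real.exp (m ^ 2 * t ^ 2 / 4) * M, fun r s hs => ?_⟩
  have hs' := hs
  rw [uIoc_of_le ht.le] at hs'
  rw [norm_smul]
  exact mul_le_mul (abs_memoryKernel_le hm hs'.1.le hs'.2) (hM s hs) (norm_nonneg _)
    (by positivity)

theorem exists_norm_memoryTerm_le (hm : 0 < m) (hζ : ContinuousOn ζ (Ici 0)) (ht : 0 < t) :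
    ∃ B, ∀ r, ‖memoryTerm m ζ t r‖ ≤ B := by
  obtain ⟨B, hB⟩ := exists_norm_memoryKernel_smul_le hm hζ ht
  exact ⟨_, fun r => intervalIntegral.norm_integral_le_of_norm_le_const (hB r)⟩

theorem continuousAt_memoryTerm (hm : 0 < m) (hζ : ContinuousOn ζ (Ici 0)) (ht : 0 < t) {r₀ : ℝ}
    (hr₀ : 0 ≤ r₀) : ContinuousAt (memoryTerm m ζ t) r₀ := by
  obtain ⟨B, hB⟩ := exists_norm_memoryKernel_smul_le hm hζ ht
  refine intervalIntegral.continuousAt_of_dominated_interval (bound := fun _ => B)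
    (Eventually.of_forall fun r => ?_)
    (Eventually.of_forall fun r => Eventually.of_forall fun s => hB r s)
    intervalIntegrable_const ?_
  · refine (measurable_memoryKernel m r).aestronglyMeasurable.smul ?_
    rw [uIoc_of_le ht.le]
    refine ContinuousOn.aestronglyMeasurable ?_ measurableSet_Ioc
    exact hζ.comp (by fun_prop) fun s hs => sub_nonneg.2 hs.2
  · filter_upwards [Measure.ae_ne volume r₀] with s hne _
    exact (continuousAt_memoryKernel hr₀ hne).smul continuousAt_const

theorem memoryTerm_zero (ht : 0 < t) :
    memoryTerm m ζ t 0 = ∫ s in (0 : ℝ)..t, (besselJ1 (m * s) / s) • ζ (t - s) := by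
  refine intervalIntegral.integral_congr fun s hs => ?_
  rw [uIcc_of_le ht.le] at hs
  simp [memoryKernel, heaviside, hs.1, Real.sqrt_sq hs.1]

theorem memoryTerm_of_lt {r : ℝ} (ht : 0 < t) (hr : t < r) : memoryTerm m ζ t r = 0 := by
  refine (intervalIntegral.integral_congr fun s hs => ?_).trans intervalIntegral.integral_zero
  rw [uIcc_of_le ht.le] at hs
  simp [memoryKernel, heaviside, hs.2.trans_lt hr]

/-! ### The difference of the two singular terms -/

/-- The retarded term of `phiS` minus the Green function term, as a function of `r = ‖x‖`. Each of
the two is singular at `r = 0`; both are `0` at `r = 0` itself because of division by zero. -/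
noncomputable def waveTerm (m : ℝ) (ζ : ℝ → Spinor) (t r : ℝ) : Spinor :=
  (heaviside (t - r) / (4 * Real.pi * r)) • ζ (t - r)
    - (Real.exp (-(m * r)) / (4 * Real.pi * r)) • ζ t

theorem regularPart_eq (x : Space) : regularPart m ζ t x =
    waveTerm m ζ t ‖x‖ - (m / (4 * Real.pi)) • memoryTerm m ζ t ‖x‖ := by
  unfold regularPart phiS waveTerm memoryTerm memoryKernel green
  abel

/-- For `0 < r ≤ t`, `waveTerm` is this function divided by `4πr`. It vanishes at `r = 0`. -/
noncomputable def waveNumerator (m : ℝ) (ζ : ℝ → Spinor) (t r : ℝ) : Spinor :=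
  ζ (t - r) - Real.exp (-(m * r)) • ζ t

/-- Writing the quotient as a slope gives its continuity up to `r = 0`, and so its limit and its
boundedness, from differentiability at `0`. -/
theorem waveTerm_eq_dslope {r : ℝ} (hr : r ≠ 0) (hrt : r ≤ t) :
    waveTerm m ζ t r = (1 / (4 * Real.pi)) • dslope (waveNumerator m ζ t) 0 r := by
  rw [dslope_of_ne _ hr, slope_def_module, waveTerm, waveNumerator, waveNumerator]
  simp only [heaviside, sub_nonneg, hrt, if_true, sub_zero, mul_zero, neg_zero, Real.exp_zero,
    one_smul, sub_self, smul_sub, smul_smul]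
  congr 2 <;> field_simp

theorem hasDerivAt_waveNumerator (hζ : ContDiffOn ℝ 1 ζ (Ici 0)) (ht : 0 < t) :
    HasDerivAt (waveNumerator m ζ t) (m • ζ t - dot ζ t) 0 := by
  have h1 : HasDerivAt ζ (dot ζ t) (t - 0) := by
    rw [sub_zero]
    exact ((hζ.differentiableOn one_ne_zero) t ht.le).hasDerivWithinAt.hasDerivAt (Ici_mem_nhds ht)
  have h2 : HasDerivAt (fun r : ℝ => t - r) (-1) 0 := (hasDerivAt_id 0).const_sub t
  have h3 : HasDerivAt (fun r : ℝ => Real.exp (-(m * r))) (-m) 0 := by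
    simpa using ((hasDerivAt_id (0 : ℝ)).const_mul m).neg.exp
  exact ((h1.scomp 0 h2).sub (h3.smul_const (ζ t))).congr_deriv (by module)

theorem continuousOn_dslope_waveNumerator (hζ : ContDiffOn ℝ 1 ζ (Ici 0)) (ht : 0 < t) :
    ContinuousOn (dslope (waveNumerator m ζ t) 0) (Iic t) := by
  refine (continuousOn_dslope (Iic_mem_nhds ht)).2
    ⟨?_, (hasDerivAt_waveNumerator hζ ht).differentiableAt⟩
  have h : ContinuousOn (fun r => ζ (t - r)) (Iic t) :=
    hζ.continuousOn.comp (by fun_prop) fun r hr => mem_Ici.2 (sub_nonneg.2 hr)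
  exact h.sub (Continuous.continuousOn (by fun_prop))

theorem tendsto_waveTerm (hζ : ContDiffOn ℝ 1 ζ (Ici 0)) (ht : 0 < t) :
    Tendsto (waveTerm m ζ t) (𝓝[≠] 0) (𝓝 ((1 / (4 * Real.pi)) • (m • ζ t - dot ζ t))) := by
  have h := ((continuousOn_dslope_waveNumerator (m := m) hζ ht).continuousAt
    (Iic_mem_nhds ht)).tendsto.const_smul (1 / (4 * Real.pi))
  rw [dslope_same, (hasDerivAt_waveNumerator hζ ht).deriv] at h
  refine (h.mono_left nhdsWithin_le_nhds).congr' ?_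
  filter_upwards [self_mem_nhdsWithin, nhdsWithin_le_nhds (Iic_mem_nhds ht)] with r hr hrt
  exact (waveTerm_eq_dslope hr hrt).symm

theorem waveTerm_of_lt {r : ℝ} (hr : t < r) :
    waveTerm m ζ t r = -(Real.exp (-(m * r)) / (4 * Real.pi * r)) • ζ t := by
  simp [waveTerm, heaviside, hr]

theorem continuousAt_waveTerm (hζ : ContDiffOn ℝ 1 ζ (Ici 0)) (ht : 0 < t) {r : ℝ} (hr : 0 < r)
    (hrt : r ≠ t) : ContinuousAt (waveTerm m ζ t) r := by
  rcases lt_or_gt_of_ne hrt with h | h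
  · refine (((continuousOn_dslope_waveNumerator (m := m) hζ ht).continuousAt
      (Iic_mem_nhds h)).const_smul (1 / (4 * Real.pi))).congr ?_
    filter_upwards [lt_mem_nhds hr, Iic_mem_nhds h] with s hs hst
    exact (waveTerm_eq_dslope hs.ne' hst).symm
  · have hne : 4 * Real.pi * r ≠ 0 := by positivity
    refine ContinuousAt.congr
      (f := fun r => -(Real.exp (-(m * r)) / (4 * Real.pi * r)) • ζ t) ?_ ?_
    · fun_prop (disch := assumption)
    · filter_upwards [lt_mem_nhds h] with s hs
      exact (waveTerm_of_lt hs).symm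

theorem exists_norm_waveTerm_le (hζ : ContDiffOn ℝ 1 ζ (Ici 0)) (ht : 0 < t) :
    ∃ K, ∀ r ∈ Icc 0 t, ‖waveTerm m ζ t r‖ ≤ K := by
  obtain ⟨K, hK⟩ := isCompact_Icc.exists_bound_of_continuousOn
    (((continuousOn_dslope_waveNumerator (m := m) hζ ht).mono
      (Icc_subset_Iic_self : Icc 0 t ⊆ Iic t)).const_smul (1 / (4 * Real.pi)))
  refine ⟨K, fun r hr => ?_⟩
  rcases eq_or_ne r 0 with rfl | h0
  · simpa [waveTerm] using (norm_nonneg _).trans (hK 0 hr)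
  · rw [waveTerm_eq_dslope h0 hr.2]
    exact hK r hr

/-! ### The regular part of the field -/

theorem tendsto_regularPart (hm : 0 < m) (hζ : ContDiffOn ℝ 1 ζ (Ici 0)) (ht : 0 < t) :
    Tendsto (regularPart m ζ t) (𝓝[≠] 0) (𝓝 (limitValue m ζ t)) := by
  have hn : Tendsto (fun x : Space => ‖x‖) (𝓝[≠] 0) (𝓝[≠] 0) :=
    tendsto_norm_nhdsNE_zero.mono_right (nhdsWithin_mono _ fun r hr => (ne_of_gt hr))
  have h1 := (tendsto_waveTerm (m := m) hζ ht).comp hn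
  have h2 := ((continuousAt_memoryTerm hm hζ.continuousOn ht le_rfl).tendsto.mono_left
    nhdsWithin_le_nhds).comp hn
  have h := h1.sub (h2.const_smul (m / (4 * Real.pi)))
  rw [memoryTerm_zero ht] at h
  convert h using 1
  · funext x; exact regularPart_eq x
  · congr 1
    rw [limitValue, smul_sub _ (_ - _), smul_smul _ m, one_div_mul_eq_div]

theorem continuousAt_regularPart (hm : 0 < m) (hζ : ContDiffOn ℝ 1 ζ (Ici 0)) (ht : 0 < t)
    {x : Space} (hx : x ≠ 0) (hxt : ‖x‖ ≠ t) : ContinuousAt (regularPart m ζ t) x := by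
  have h1 : ContinuousAt (fun x : Space => waveTerm m ζ t ‖x‖) x :=
    ContinuousAt.comp (f := fun x : Space => ‖x‖)
      (continuousAt_waveTerm hζ ht (norm_pos_iff.2 hx) hxt) continuous_norm.continuousAt
  have h2 : ContinuousAt (fun x : Space => memoryTerm m ζ t ‖x‖) x :=
    ContinuousAt.comp (f := fun x : Space => ‖x‖)
      (continuousAt_memoryTerm hm hζ.continuousOn ht (norm_nonneg x)) continuous_norm.continuousAt
  rw [show regularPart m ζ t = _ from funext regularPart_eq]
  exact ContinuousAt.sub h1 (h2.const_smul (m / (4 * Real.pi)) :)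

theorem ae_continuousAt_regularPart (hm : 0 < m) (hζ : ContDiffOn ℝ 1 ζ (Ici 0)) (ht : 0 < t) :
    ∀ᵐ x, ContinuousAt (regularPart m ζ t) x := by
  have hs : ∀ᵐ x : Space, x ∉ Metric.sphere (0 : Space) t :=
    measure_eq_zero_iff_ae_notMem.1 (Measure.addHaar_sphere _ _ _)
  filter_upwards [Measure.ae_ne volume (0 : Space), hs] with x h0 hx
  exact continuousAt_regularPart hm hζ ht h0 (by simpa using hx)

theorem stronglyMeasurable_regularPart (hm : 0 < m) (hζ : ContDiffOn ℝ 1 ζ (Ici 0)) (ht : 0 < t) :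
    StronglyMeasurable (regularPart m ζ t) := by
  -- `ζ` is continuous only on `[0, ∞)`; the Heaviside factor removes the values at negative times.
  have h1 : Continuous fun r => ζ (max 0 (t - r)) :=
    hζ.continuousOn.comp_continuous (by fun_prop) fun r => mem_Ici.2 (le_max_left _ _)
  have h2 : Continuous fun r => memoryTerm m ζ t (max 0 r) :=
    continuous_iff_continuousAt.2 fun r => ContinuousAt.comp (f := fun r : ℝ => max 0 r)
      (continuousAt_memoryTerm hm hζ.continuousOn ht (le_max_left 0 r)) (by fun_prop)
  have h3 : regularPart m ζ t = fun x : Space =>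
      ((heaviside (t - ‖x‖) / (4 * Real.pi * ‖x‖)) • ζ (max 0 (t - ‖x‖))
        - (Real.exp (-(m * ‖x‖)) / (4 * Real.pi * ‖x‖)) • ζ t)
      - (m / (4 * Real.pi)) • memoryTerm m ζ t (max 0 ‖x‖) := by
    funext x
    rw [regularPart_eq, waveTerm, max_eq_right (norm_nonneg x)]
    rcases le_or_gt ‖x‖ t with h | h
    · rw [max_eq_right (sub_nonneg.2 h)]
    · simp [heaviside, h.not_ge]
  have h4 := measurable_heaviside
  have h5 : Measurable fun x : Space => ζ (max 0 (t - ‖x‖)) := h1.measurable.comp measurable_norm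
  have h6 : Measurable fun x : Space => memoryTerm m ζ t (max 0 ‖x‖) :=
    h2.measurable.comp measurable_norm
  rw [h3]
  refine Measurable.stronglyMeasurable
    ((Measurable.sub ?_ ?_).sub (h6.const_smul (m / (4 * Real.pi)) :))
  · exact Measurable.smul (f := fun x : Space => heaviside (t - ‖x‖) / (4 * Real.pi * ‖x‖))
      (by fun_prop) h5
  · exact Measurable.smul_const (by fun_prop) (ζ t)

/-- By finite propagation speed only the Green function is left for `‖x‖ > t`. -/
theorem exists_norm_regularPart_le (hm : 0 < m) (hζ : ContDiffOn ℝ 1 ζ (Ici 0)) (ht : 0 < t) :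
    ∃ C, 0 ≤ C ∧ ∀ x, ‖regularPart m ζ t x‖ ≤ C * Real.exp (-(m * ‖x‖)) := by
  obtain ⟨K, hK⟩ := exists_norm_waveTerm_le (m := m) hζ ht
  obtain ⟨B, hB⟩ := exists_norm_memoryTerm_le hm hζ.continuousOn ht
  have hK0 : 0 ≤ K := (norm_nonneg _).trans (hK 0 ⟨le_rfl, ht.le⟩)
  have hB0 : 0 ≤ B := (norm_nonneg _).trans (hB 0)
  set D := (K + m / (4 * Real.pi) * B) * Real.exp (m * t) with hD
  have hD0 : 0 ≤ D := by positivity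
  have hE0 : 0 ≤ ‖ζ t‖ / (4 * Real.pi * t) := by positivity
  refine ⟨D + ‖ζ t‖ / (4 * Real.pi * t), by positivity, fun x => ?_⟩
  rw [regularPart_eq]
  rcases le_or_gt ‖x‖ t with h | h
  · have h1 : ‖waveTerm m ζ t ‖x‖ - (m / (4 * Real.pi)) • memoryTerm m ζ t ‖x‖‖
        ≤ K + m / (4 * Real.pi) * B := by
      refine (norm_sub_le _ _).trans (add_le_add (hK _ ⟨norm_nonneg x, h⟩) ?_)
      rw [norm_smul, Real.norm_of_nonneg (by positivity)]
      gcongr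
      exact hB _
    have h2 : K + m / (4 * Real.pi) * B ≤ D * Real.exp (-(m * ‖x‖)) := by
      rw [hD, mul_assoc, ← Real.exp_add]
      refine le_mul_of_one_le_right (by positivity) (Real.one_le_exp ?_)
      nlinarith
    refine h1.trans (h2.trans ?_)
    gcongr
    linarith
  · rw [waveTerm_of_lt h, memoryTerm_of_lt ht h, smul_zero, sub_zero, norm_smul, norm_neg,
      Real.norm_of_nonneg (by positivity)]
    calc Real.exp (-(m * ‖x‖)) / (4 * Real.pi * ‖x‖) * ‖ζ t‖
        ≤ Real.exp (-(m * ‖x‖)) / (4 * Real.pi * t) * ‖ζ t‖ := by gcongr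
      _ = ‖ζ t‖ / (4 * Real.pi * t) * Real.exp (-(m * ‖x‖)) := by ring
      _ ≤ _ := by gcongr; linarith

theorem integrable_exp_neg_mul_norm {c : ℝ} (hc : 0 < c) :
    Integrable (fun x : Space => Real.exp (-(c * ‖x‖))) := by
  have hd : (Module.finrank ℝ Space : ℝ) < (4 : ℕ) := by
    rw [finrank_euclideanSpace_fin]; norm_num
  refine ((integrable_one_add_norm (μ := volume) hd).const_mul
    (Real.exp c * ((4).factorial / c ^ 4))).mono'
    (Continuous.aestronglyMeasurable (by fun_prop)) (Eventually.of_forall fun x => ?_)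
  have h1 : 0 < 1 + ‖x‖ := by positivity
  have h2 := Real.pow_div_factorial_le_exp (c * (1 + ‖x‖)) (by positivity) 4
  rw [Real.norm_of_nonneg (Real.exp_nonneg _), Real.rpow_neg h1.le, Real.rpow_natCast,
    show -(c * ‖x‖) = c - c * (1 + ‖x‖) by ring, Real.exp_sub, mul_assoc, div_eq_mul_inv]
  refine mul_le_mul_of_nonneg_left ?_ (Real.exp_nonneg _)
  refine (inv_anti₀ (by positivity) h2).trans_eq ?_
  rw [mul_pow]; field_simp

theorem memLp_regularPart (hm : 0 < m) (hζ : ContDiffOn ℝ 1 ζ (Ici 0)) (ht : 0 < t) :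
    MemLp (regularPart m ζ t) 2 volume := by
  obtain ⟨C, hC0, hC⟩ := exists_norm_regularPart_le hm hζ ht
  have hexp : MemLp (fun x : Space => Real.exp (-(m * ‖x‖))) 2 volume := by
    rw [memLp_two_iff_integrable_sq (Continuous.aestronglyMeasurable (by fun_prop))]
    refine (integrable_exp_neg_mul_norm (mul_pos two_pos hm)).congr
      (Eventually.of_forall fun x => ?_)
    simp only [← Real.exp_nat_mul]
    congr 1; push_cast; ring
  refine hexp.of_le_mul (c := C) (stronglyMeasurable_regularPart hm hζ ht).aestronglyMeasurable
    (Eventually.of_forall fun x => ?_)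
  rw [Real.norm_of_nonneg (Real.exp_nonneg _)]
  exact hC x

end ConcentratedDirac

theorem lemma4p1 (m : ℝ) (hm : 0 < m) (ζ : ℝ → ConcentratedDirac.Spinor)
    (hζ : ContDiffOn ℝ 1 ζ (Ici 0))
    (hζ2 : ∃ η : ℝ → ConcentratedDirac.Spinor, ConcentratedDirac.LocallyL2 η ∧
      ConcentratedDirac.IsWeakDeriv (ConcentratedDirac.dot ζ) η)
    (t : ℝ) (ht : 0 < t) :
    (∃ hf : MemLp (ConcentratedDirac.regularPart m ζ t) 2 volume,
      ConcentratedDirac.HasRenormalizedLimit m hm (hf.toLp _)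
        (ConcentratedDirac.limitValue m ζ t)) ∧
    Tendsto (ConcentratedDirac.regularPart m ζ t) (𝓝[≠] 0)
      (𝓝 (ConcentratedDirac.limitValue m ζ t)) := by
  have hL := ConcentratedDirac.tendsto_regularPart hm hζ ht
  obtain ⟨C, hC0, hC⟩ := ConcentratedDirac.exists_norm_regularPart_le hm hζ ht
  refine ⟨⟨ConcentratedDirac.memLp_regularPart hm hζ ht,
    ConcentratedDirac.hasRenormalizedLimit_toLp hm
      (ConcentratedDirac.stronglyMeasurable_regularPart hm hζ ht) (C := C) (fun x => ?_)
      (ConcentratedDirac.ae_continuousAt_regularPart hm hζ ht) hL _⟩, hL⟩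
  refine (hC x).trans (mul_le_of_le_one_right hC0 (Real.exp_le_one_iff.2 ?_))
  have : 0 ≤ m * ‖x‖ := by positivity
  linarith
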